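/- Let $\bar\gamma=(\gamma_1,\dots,\gamma_n)$ be directional functions, i.e. continuous functions $\gamma_i:\mathbb S^{d-1}\to(0,\infty)$ bounded above and below by positive constants. Put $\mathbb S^{d-1}_{\gamma_i}=\{\gamma_i(x)x : x\in\mathbb S^{d-1}\}$, and let $\mathbb S(n,d,\bar\gamma)$ be the set of matrices $X\in\mathbb R^{n\times d}$ whose $i$-th row lies in $\mathbb S^{d-1}_{\gamma_i}$ for every $i$. Let $A=[a_{ij}]\in\mathbb R^{n\times n}$ be a nonnegative weight matrix for a strongly connected directed graph on $\{1,\dots,n\}$ ($a_{ij}>0$ if $(i,j)$ is an edge, $a_{ij}=0$ otherwise) such that $$a_{ii}\min_{x\in\mathbb S^{d-1}}\gamma_i(x)>\sum_{j\ne i}a_{ij}\max_{x\in\mathbb S^{d-1}}\gamma_j(x)\qquad\text{for all } i.$$ For $X_0\in\mathbb S(n,d,\bar\gamma)$ and $t_0\in\{0,1,2,\dots\}$, let $X(t)$, $t\ge t_0$, with rows $x_1(t),\dots,x_n(t)$, be given by $X(t_0)=X_0$ and $$x_i(t+1)=\gamma_i\!\left(\frac{y_i(t)}{\|y_i(t)\|_2}\right)\frac{y_i(t)}{\|y_i(t)\|_2},\qquad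 y_i(t)=\sum_{j=1}^n a_{ij}x_j(t).$$ Asymptotic consensus of directions with point-wise convergence means that there is $u\in\mathbb S^{d-1}$ with $\left\|\frac{x_i(t)}{\|x_i(t)\|_2}-u\right\|_2\to0$ as $t\to\infty$ for all $i$. Then: 1. The set $\Omega$ of all $X_0\in\mathbb S(n,d,\bar\gamma)$ that lead to asymptotic consensus of directions with point-wise convergence is open in $\mathbb S(n,d,\bar\gamma)$. 2. For $X_0\in\Omega$, let $u(X_0)$ be the consensus direction. The states converge as well: $X(t)\to X_\infty(X_0)$, where the $i$-th row of $X_\infty(X_0)$ is $\gamma_i(u(X_0))\,u(X_0)$ (in particular, if all $\gamma_i$ are equal, all agents converge to the same state). Both $u$ and $X_\infty$ are continuous on $\Omega$. -/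

import Mathlib

open Filter Topology

namespace StarConsensus

/-- Row vectors in `ℝ^d` with the Euclidean norm. -/
abbrev Vec (d : ℕ) : Type := EuclideanSpace ℝ (Fin d)

/-- A real `n × d` matrix, given as the family of its `n` rows. -/
abbrev RowMat (n d : ℕ) : Type := Fin n → Vec d

/-- The Euclidean unit sphere in `ℝ^d`. -/
abbrev unitSphere (d : ℕ) : Set (Vec d) := Metric.sphere (0 : Vec d) 1

/-- A directional function: continuous on the unit sphere, and bounded there from below and from
above by positive constants. Only the values of `γ` on the unit sphere are ever used. -/
structure IsDirectional {d : ℕ} (γ : Vec d → ℝ) : Prop where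
  continuousOn : ContinuousOn γ (unitSphere d)
  bounded : ∃ c C : ℝ, 0 < c ∧ 0 < C ∧ ∀ x ∈ unitSphere d, c ≤ γ x ∧ γ x ≤ C

/-- The star boundary of a directional function. -/
def starBoundary {d : ℕ} (γ : Vec d → ℝ) : Set (Vec d) :=
  {y | ∃ x ∈ unitSphere d, y = γ x • x}

/-- The set of matrices whose `i`-th row lies on the `i`-th star boundary. -/
def stateSpace {n d : ℕ} (γ : Fin n → Vec d → ℝ) : Set (RowMat n d) :=
  {X | ∀ i, X i ∈ starBoundary (γ i)}

/-- The direction `x / ‖x‖` of a nonzero vector `x`. -/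
noncomputable def direction {d : ℕ} (x : Vec d) : Vec d := ‖x‖⁻¹ • x

/-- The radial projection of a nonzero vector onto a star boundary. -/
noncomputable def radialProj {d : ℕ} (γ : Vec d → ℝ) (x : Vec d) : Vec d :=
  γ (direction x) • direction x

/-- One step of the algorithm: row `i` of `X` becomes the radial projection of row `i` of `A X`. -/
noncomputable def step {n d : ℕ} (A : Matrix (Fin n) (Fin n) ℝ) (γ : Fin n → Vec d → ℝ)
    (X : RowMat n d) : RowMat n d :=
  fun i => radialProj (γ i) (∑ j, A i j • X j)

/-- The state `X(t)` at time `t ≥ t₀` of the solution of the algorithm with `X(t₀) = X₀`. -/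
noncomputable def traj {n d : ℕ} (A : Matrix (Fin n) (Fin n) ℝ) (γ : Fin n → Vec d → ℝ)
    (t₀ : ℕ) (X₀ : RowMat n d) (t : ℕ) : RowMat n d :=
  (step A γ)^[t - t₀] X₀

/-- A directed graph is strongly connected if there is a directed path from each node to each
node. -/
def StronglyConnected {V : Type*} (G : Digraph V) : Prop :=
  ∀ i j : V, Relation.ReflTransGen G.Adj i j

/-- `A` is a nonnegative weight matrix for the directed graph `G`. -/
def IsWeightMatrix {n : ℕ} (A : Matrix (Fin n) (Fin n) ℝ) (G : Digraph (Fin n)) : Prop :=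
  ∀ i j, (G.Adj i j → 0 < A i j) ∧ (¬ G.Adj i j → A i j = 0)

/-- The standing assumption on the weights and the star boundaries. The infimum and the supremum
over the unit sphere are a minimum and a maximum, the functions being continuous on a compact
set. -/
structure Admissible {n d : ℕ} (A : Matrix (Fin n) (Fin n) ℝ) (γ : Fin n → Vec d → ℝ) :
    Prop where
  directional : ∀ i, IsDirectional (γ i)
  weight : ∃ G : Digraph (Fin n), StronglyConnected G ∧ IsWeightMatrix A G
  dominant : ∀ i, ∑ j ∈ Finset.univ.erase i, A i j * (⨆ x : unitSphere d, γ j x) <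
    A i i * (⨅ x : unitSphere d, γ i x)

/-- The directions of all rows of `X(t)` converge to the vector `u`. -/
def DirectionsTendTo {n d : ℕ} (X : ℕ → RowMat n d) (u : Vec d) : Prop :=
  ∀ i, Tendsto (fun t => ‖direction (X t i) - u‖) atTop (𝓝 0)

/-- Asymptotic consensus of directions with point-wise convergence. -/
def PointwiseDirectionConsensus {n d : ℕ} (X : ℕ → RowMat n d) : Prop :=
  ∃ u ∈ unitSphere d, DirectionsTendTo X u

/-- The set of initial states, as a subset of the state space (with the subspace topology), that
lead to asymptotic consensus of directions with point-wise convergence. -/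
def consensusSet {n d : ℕ} (A : Matrix (Fin n) (Fin n) ℝ) (γ : Fin n → Vec d → ℝ) (t₀ : ℕ) :
    Set (stateSpace γ) :=
  {X₀ | PointwiseDirectionConsensus (traj A γ t₀ X₀)}

end StarConsensus

/-!
Consensus is a locally stable outcome of the dynamics, and the stability is quantitative enough to
control the consensus direction.

Suppose that at some time all rows `x_i` lie in an open half-space `{x | 0 < ⟪u, x⟫}`. Project them
centrally to the hyperplane `{x | ⟪u, x⟫ = 1}`: with `p_i = x_i / ⟪u, x_i⟫`, one step of the
nonlinear algorithm replaces `p_i` by a weighted mean of the `p_j`, with weights proportional to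
`a_ij ⟪u, x_j⟫` (`centralProj_step`). If the `p_i` start in a closed ball around `u`, they stay
there by convexity, so that the weights along the edges of the graph are bounded below
(`exists_le_projWeight`). Diagonal dominance gives positive self-weights, and the graph is strongly
connected; hence every coordinate of the `p_i` reaches consensus by the classical contraction of
the spread `max - min` (`exists_tendsto_of_averaging`). The common limit `p` lies in the same ball,
and the consensus direction is `p / ‖p‖` (`exists_consensus_of_nearConsensus`).

If `X₀` leads to consensus in the direction `u`, then at some finite time `T` the `p_i` lie in a
prescribed small ball around `u`. Diagonal dominance keeps the vectors to be normalized nonzero, so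
the step map and its `T`-th iterate are continuous on the state space, and the same holds for all
initial states near `X₀`. These therefore reach consensus, in a direction close to `u`
(`eventually_exists_consensus`). This is both the openness of the consensus set and the continuity
of the consensus direction. The limit states are continuous functions of that direction.
-/

namespace StarConsensus

/-! ### Consensus of averaging with time-dependent weights -/

section Averaging

variable {ι : Type*} [Fintype ι] {R : ι → ι → Prop} {B : ℕ → ι → ι → ℝ} {q : ℕ → ι → ℝ} {η : ℝ}

theorem averaging_le (hB : ∀ t i j, 0 ≤ B t i j) (hsum : ∀ t i, ∑ j, B t i j = 1)
    (hq : ∀ t i, q (t + 1) i = ∑ j, B t i j * q t j) {t : ℕ} {m : ℝ} (hm : ∀ k, m ≤ q t k)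
    (s : ℕ) (i : ι) : m ≤ q (t + s) i := by
  induction s generalizing i with
  | zero => exact hm i
  | succ s ih =>
    rw [← add_assoc, hq, ← mul_one m, ← hsum (t + s) i, Finset.mul_sum]
    refine Finset.sum_le_sum fun j _ => ?_
    rw [mul_comm]
    exact mul_le_mul_of_nonneg_left (ih j) (hB _ _ _)

theorem le_averaging (hB : ∀ t i j, 0 ≤ B t i j) (hsum : ∀ t i, ∑ j, B t i j = 1)
    (hq : ∀ t i, q (t + 1) i = ∑ j, B t i j * q t j) {t : ℕ} {M : ℝ} (hM : ∀ k, q t k ≤ M)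
    (s : ℕ) (i : ι) : q (t + s) i ≤ M := by
  have h := averaging_le (q := fun t i => -q t i) (m := -M) hB hsum
    (fun t i => by simp [hq]) (t := t) (fun k => neg_le_neg (hM k)) s i
  exact neg_le_neg_iff.mp h

/-- One averaging step along an edge `(i, k)`: the excess of the value at `k` over a common lower
bound `m` passes to `i` up to the factor `η`. -/
theorem mul_excess_le (hB : ∀ t i j, 0 ≤ B t i j) (hsum : ∀ t i, ∑ j, B t i j = 1)
    (hR : ∀ t i j, R i j → η ≤ B t i j)
    (hq : ∀ t i, q (t + 1) i = ∑ j, B t i j * q t j) {t : ℕ} {m : ℝ} (hm : ∀ k, m ≤ q t k)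
    {i k : ι} (hik : R i k) : η * (q t k - m) ≤ q (t + 1) i - m := by
  have h : q (t + 1) i - m = ∑ j, B t i j * (q t j - m) := by
    simp only [mul_sub, Finset.sum_sub_distrib, ← Finset.sum_mul, hsum, one_mul, hq]
  rw [h]
  calc η * (q t k - m) ≤ B t i k * (q t k - m) :=
        mul_le_mul_of_nonneg_right (hR t i k hik) (sub_nonneg.2 (hm k))
    _ ≤ _ := Finset.single_le_sum (f := fun j => B t i j * (q t j - m))
        (fun j _ => mul_nonneg (hB t i j) (sub_nonneg.2 (hm j))) (Finset.mem_univ k)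

/-- Following a path from `i` to `k` (and waiting at `k` thanks to the self-loop), the excess at
`k` reaches `i` after any sufficiently large number `s` of steps, up to the factor `η ^ s`. -/
theorem eventually_pow_mul_excess_le (hη : 0 < η) (hB : ∀ t i j, 0 ≤ B t i j)
    (hsum : ∀ t i, ∑ j, B t i j = 1) (hR : ∀ t i j, R i j → η ≤ B t i j) (hrefl : ∀ i, R i i)
    (hq : ∀ t i, q (t + 1) i = ∑ j, B t i j * q t j) {i k : ι}
    (hik : Relation.ReflTransGen R i k) :
    ∀ᶠ s : ℕ in atTop, ∀ t m, (∀ l, m ≤ q t l) → η ^ s * (q t k - m) ≤ q (t + s) i - m := by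
  induction hik using Relation.ReflTransGen.head_induction_on with
  | refl =>
    refine Eventually.of_forall fun s t m hm => ?_
    induction s with
    | zero => simp
    | succ s ih =>
      calc η ^ (s + 1) * (q t k - m) = η * (η ^ s * (q t k - m)) := by ring
        _ ≤ η * (q (t + s) k - m) := mul_le_mul_of_nonneg_left ih hη.le
        _ ≤ _ := mul_excess_le hB hsum hR hq (averaging_le hB hsum hq hm s) (hrefl k)
  | head hij _ ih =>
    obtain ⟨s₀, hs₀⟩ := eventually_atTop.1 ih
    refine eventually_atTop.2 ⟨s₀ + 1, fun s hs t m hm => ?_⟩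
    obtain ⟨s, rfl⟩ : ∃ r, s = r + 1 := ⟨s - 1, by omega⟩
    rw [pow_succ', mul_assoc]
    exact (mul_le_mul_of_nonneg_left (hs₀ s (by omega) t m hm) hη.le).trans
      (mul_excess_le hB hsum hR hq (averaging_le hB hsum hq hm s) hij)

/-- Repeated averaging with time-dependent weights leads to consensus when the weights are bounded
below along the edges of a reflexive strongly connected graph: over a fixed number of steps the
spread `max q - min q` shrinks by a fixed factor. -/
theorem exists_tendsto_of_averaging (hη : 0 < η) (hB : ∀ t i j, 0 ≤ B t i j)
    (hsum : ∀ t i, ∑ j, B t i j = 1) (hR : ∀ t i j, R i j → η ≤ B t i j) (hrefl : ∀ i, R i i)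
    (hconn : ∀ i j, Relation.ReflTransGen R i j)
    (hq : ∀ t i, q (t + 1) i = ∑ j, B t i j * q t j) :
    ∃ c, ∀ i, Tendsto (fun t => q t i) atTop (𝓝 c) := by
  cases isEmpty_or_nonempty ι
  · exact ⟨0, fun i => isEmptyElim i⟩
  set M : ℕ → ℝ := fun t => ⨆ i, q t i
  set m : ℕ → ℝ := fun t => ⨅ i, q t i
  have hM : ∀ t i, q t i ≤ M t := fun t i => le_ciSup (Set.finite_range (q t)).bddAbove i
  have hm : ∀ t i, m t ≤ q t i := fun t i => ciInf_le (Set.finite_range (q t)).bddBelow i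
  have hMm : ∀ t, m t ≤ M t := fun t => (hm t (Classical.arbitrary ι)).trans (hM t _)
  have hManti : Antitone M := antitone_nat_of_succ_le fun t =>
    ciSup_le fun i => le_averaging hB hsum hq (hM t) 1 i
  have hmmono : Monotone m := monotone_nat_of_le_succ fun t =>
    le_ciInf fun i => averaging_le hB hsum hq (hm t) 1 i
  have hMlim := tendsto_atTop_ciInf hManti
    ⟨m 0, by rintro _ ⟨t, rfl⟩; exact (hmmono (Nat.zero_le t)).trans (hMm t)⟩
  have hmlim := tendsto_atTop_ciSup hmmono
    ⟨M 0, by rintro _ ⟨t, rfl⟩; exact (hMm t).trans (hManti (Nat.zero_le t))⟩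
  set c := ⨅ t, M t
  set c' := ⨆ t, m t
  obtain ⟨N, hN⟩ := (eventually_all.2 fun i => eventually_all.2 fun k =>
    eventually_pow_mul_excess_le hη hB hsum hR hrefl hq (hconn i k)).exists
  have hgap : ∀ t, M (t + N) - m (t + N) ≤ (1 - η ^ N) * (M t - m t) := by
    intro t
    obtain ⟨k, hk⟩ := exists_eq_ciSup_of_finite (f := q t)
    have h1 : m t + η ^ N * (M t - m t) ≤ m (t + N) := le_ciInf fun i => by
      have := hN i k t (m t) (hm t)
      rw [hk] at this
      linarith
    have h2 := hManti (Nat.le_add_right t N)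
    linarith
  have hcc : c = c' := by
    refine le_antisymm ?_ (le_of_tendsto_of_tendsto' hmlim hMlim hMm)
    have h := le_of_tendsto_of_tendsto'
      ((hMlim.comp (tendsto_add_atTop_nat N)).sub (hmlim.comp (tendsto_add_atTop_nat N)))
      ((hMlim.sub hmlim).const_mul (1 - η ^ N)) hgap
    have : η ^ N * (c - c') ≤ 0 := by linarith
    have := nonpos_of_mul_nonpos_right this (pow_pos hη N)
    linarith
  exact ⟨c, fun i => tendsto_of_tendsto_of_tendsto_of_le_of_le (hcc ▸ hmlim) hMlim
    (fun t => hm t i) (fun t => hM t i)⟩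

end Averaging

/-! ### Directions and star boundaries -/

section Direction

variable {d : ℕ}

theorem norm_direction {x : Vec d} (hx : x ≠ 0) : ‖direction x‖ = 1 := by
  simp [direction, norm_smul, hx]

theorem direction_mem_unitSphere {x : Vec d} (hx : x ≠ 0) : direction x ∈ unitSphere d := by
  simpa using norm_direction hx

theorem direction_smul {r : ℝ} (hr : 0 < r) (x : Vec d) : direction (r • x) = direction x := by
  simp only [direction, norm_smul, smul_smul, Real.norm_of_nonneg hr.le]
  congr 1
  field_simp

theorem direction_of_mem_unitSphere {x : Vec d} (hx : x ∈ unitSphere d) : direction x = x := by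
  have : ‖x‖ = 1 := by simpa using hx
  simp [direction, this]

theorem ne_zero_of_mem_unitSphere {x : Vec d} (hx : x ∈ unitSphere d) : x ≠ 0 :=
  ne_zero_of_mem_unit_sphere ⟨x, hx⟩

theorem continuousAt_direction {x : Vec d} (hx : x ≠ 0) : ContinuousAt direction x :=
  (continuousAt_id.norm.inv₀ (norm_ne_zero_iff.2 hx)).smul continuousAt_id

theorem IsDirectional.pos {γ : Vec d → ℝ} (hγ : IsDirectional γ) {x : Vec d}
    (hx : x ∈ unitSphere d) : 0 < γ x := by
  obtain ⟨c, C, hc, -, h⟩ := hγ.bounded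
  exact hc.trans_le (h x hx).1

theorem radialProj_mem_starBoundary {γ : Vec d → ℝ} {x : Vec d} (hx : x ≠ 0) :
    radialProj γ x ∈ starBoundary γ :=
  ⟨direction x, direction_mem_unitSphere hx, rfl⟩

theorem direction_of_mem_starBoundary {γ : Vec d → ℝ} (hγ : IsDirectional γ) {x : Vec d}
    (hx : x ∈ starBoundary γ) :
    direction x ∈ unitSphere d ∧ x = γ (direction x) • direction x := by
  obtain ⟨z, hz, rfl⟩ := hx
  rw [direction_smul (hγ.pos hz), direction_of_mem_unitSphere hz]
  exact ⟨hz, rfl⟩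

theorem norm_of_mem_starBoundary {γ : Vec d → ℝ} (hγ : IsDirectional γ) {x : Vec d}
    (hx : x ∈ starBoundary γ) : ‖x‖ = γ (direction x) := by
  obtain ⟨h1, h2⟩ := direction_of_mem_starBoundary hγ hx
  have h3 : ‖direction x‖ = 1 := by simpa using h1
  conv_lhs => rw [h2, norm_smul, h3, mul_one, Real.norm_of_nonneg (hγ.pos h1).le]

theorem ne_zero_of_mem_starBoundary {γ : Vec d → ℝ} (hγ : IsDirectional γ) {x : Vec d}
    (hx : x ∈ starBoundary γ) : x ≠ 0 := by
  rw [← norm_pos_iff, norm_of_mem_starBoundary hγ hx]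
  exact hγ.pos (direction_of_mem_starBoundary hγ hx).1

theorem continuousAt_radialProj {γ : Vec d → ℝ} (hγ : IsDirectional γ) {x : Vec d}
    (hx : x ≠ 0) : ContinuousAt (radialProj γ) x := by
  have h : Tendsto direction (𝓝 x) (𝓝[unitSphere d] direction x) :=
    tendsto_nhdsWithin_iff.2 ⟨continuousAt_direction hx,
      (eventually_ne_nhds hx).mono fun y hy => direction_mem_unitSphere hy⟩
  exact ((hγ.continuousOn _ (direction_mem_unitSphere hx)).tendsto.comp h).smul
    (continuousAt_direction hx)

end Direction

/-! ### Weights and the step map -/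

namespace Admissible

variable {n d : ℕ} {A : Matrix (Fin n) (Fin n) ℝ} {γ : Fin n → Vec d → ℝ}

theorem weight_nonneg (hA : Admissible A γ) (i j : Fin n) : 0 ≤ A i j := by
  obtain ⟨G, -, hG⟩ := hA.weight
  by_cases h : G.Adj i j
  · exact ((hG i j).1 h).le
  · exact ((hG i j).2 h).ge

theorem weight_connected (hA : Admissible A γ) (i j : Fin n) :
    Relation.ReflTransGen (fun i j => 0 < A i j) i j := by
  obtain ⟨G, hG, hw⟩ := hA.weight
  exact Relation.ReflTransGen.mono (fun a b hab => (hw a b).1 hab) _ _ (hG i j)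

theorem diag_pos (hA : Admissible A γ) (i : Fin n) : 0 < A i i := by
  have h1 : 0 ≤ ⨅ x : unitSphere d, γ i x :=
    Real.iInf_nonneg fun x => ((hA.directional i).pos x.2).le
  have h2 : 0 ≤ ∑ j ∈ Finset.univ.erase i, A i j * (⨆ x : unitSphere d, γ j x) :=
    Finset.sum_nonneg fun j _ => mul_nonneg (hA.weight_nonneg i j)
      (Real.iSup_nonneg fun x => ((hA.directional j).pos x.2).le)
  exact pos_of_mul_pos_left (h2.trans_lt (hA.dominant i)) h1

/-- Diagonal dominance makes the weighted sum nonzero: the term of index `i` is longer than all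
others together. -/
theorem weightedSum_ne_zero (hA : Admissible A γ) {X : RowMat n d} (hX : X ∈ stateSpace γ)
    (i : Fin n) : ∑ j, A i j • X j ≠ 0 := by
  intro h0
  have hsup : ∀ j, ‖X j‖ ≤ ⨆ x : unitSphere d, γ j x := fun j => by
    obtain ⟨c, C, -, -, hC⟩ := (hA.directional j).bounded
    rw [norm_of_mem_starBoundary (hA.directional j) (hX j)]
    exact le_ciSup (f := fun x : unitSphere d => γ j x)
      ⟨C, by rintro _ ⟨x, rfl⟩; exact (hC x x.2).2⟩
      ⟨_, (direction_of_mem_starBoundary (hA.directional j) (hX j)).1⟩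
  have hinf : (⨅ x : unitSphere d, γ i x) ≤ ‖X i‖ := by
    obtain ⟨c, C, -, -, hC⟩ := (hA.directional i).bounded
    rw [norm_of_mem_starBoundary (hA.directional i) (hX i)]
    exact ciInf_le (f := fun x : unitSphere d => γ i x)
      ⟨c, by rintro _ ⟨x, rfl⟩; exact (hC x x.2).1⟩
      ⟨_, (direction_of_mem_starBoundary (hA.directional i) (hX i)).1⟩
  rw [← Finset.add_sum_erase _ _ (Finset.mem_univ i)] at h0
  have h1 : A i i * ‖X i‖ ≤ ∑ j ∈ Finset.univ.erase i, A i j * ‖X j‖ := by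
    have h2 : ‖A i i • X i‖ = ‖∑ j ∈ Finset.univ.erase i, A i j • X j‖ := by
      rw [eq_neg_of_add_eq_zero_left h0, norm_neg]
    rw [norm_smul, Real.norm_of_nonneg (hA.weight_nonneg i i)] at h2
    rw [h2]
    refine (norm_sum_le _ _).trans (Finset.sum_le_sum fun j _ => ?_)
    rw [norm_smul, Real.norm_of_nonneg (hA.weight_nonneg i j)]
  have h3 := Finset.sum_le_sum fun j (_ : j ∈ Finset.univ.erase i) =>
    mul_le_mul_of_nonneg_left (hsup j) (hA.weight_nonneg i j)
  have h4 := mul_le_mul_of_nonneg_left hinf (hA.weight_nonneg i i)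
  linarith [hA.dominant i]

theorem step_mem (hA : Admissible A γ) {X : RowMat n d} (hX : X ∈ stateSpace γ) :
    step A γ X ∈ stateSpace γ :=
  fun i => radialProj_mem_starBoundary (hA.weightedSum_ne_zero hX i)

theorem iterate_mem (hA : Admissible A γ) {X : RowMat n d} (hX : X ∈ stateSpace γ) (t : ℕ) :
    (step A γ)^[t] X ∈ stateSpace γ :=
  Set.MapsTo.iterate (fun _ => hA.step_mem) t hX

theorem continuousOn_step (hA : Admissible A γ) : ContinuousOn (step A γ) (stateSpace γ) := by
  refine continuousOn_pi.2 fun i X hX => ContinuousAt.continuousWithinAt ?_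
  exact (continuousAt_radialProj (hA.directional i) (hA.weightedSum_ne_zero hX i)).comp
    (f := fun X : RowMat n d => ∑ j, A i j • X j)
    (continuous_finsetSum _ fun j _ => (continuous_apply j).const_smul (A i j)).continuousAt

theorem continuousOn_iterate (hA : Admissible A γ) (t : ℕ) :
    ContinuousOn (step A γ)^[t] (stateSpace γ) :=
  hA.continuousOn_step.iterate (fun _ => hA.step_mem) t

end Admissible

/-! ### The dynamics in central projection from an open half-space -/

section Hemisphere

variable {n d : ℕ} {A : Matrix (Fin n) (Fin n) ℝ} {γ : Fin n → Vec d → ℝ}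

/-- The central projection of the half-space `{x | 0 < ⟪u, x⟫}` to the affine hyperplane
`{x | ⟪u, x⟫ = 1}`. -/
noncomputable def centralProj (u x : Vec d) : Vec d := (inner ℝ u x)⁻¹ • x

theorem centralProj_smul {r : ℝ} (hr : r ≠ 0) (u x : Vec d) :
    centralProj u (r • x) = centralProj u x := by
  simp only [centralProj, inner_smul_right, smul_smul]
  congr 1
  field_simp

theorem inner_self_of_mem_unitSphere {u : Vec d} (hu : u ∈ unitSphere d) : inner ℝ u u = 1 := by
  have : ‖u‖ = 1 := by simpa using hu
  rw [real_inner_self_eq_norm_sq, this, one_pow]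

theorem centralProj_direction (u : Vec d) {x : Vec d} (hx : x ≠ 0) :
    centralProj u (direction x) = centralProj u x :=
  centralProj_smul (inv_ne_zero (norm_ne_zero_iff.2 hx)) u x

theorem direction_centralProj {u x : Vec d} (hx : 0 < inner ℝ u x) :
    direction (centralProj u x) = direction x :=
  direction_smul (inv_pos.2 hx) x

theorem continuousAt_centralProj {u x : Vec d} (hx : inner ℝ u x ≠ 0) :
    ContinuousAt (centralProj u) x :=
  ContinuousAt.smul (ContinuousAt.inv₀ (by fun_prop) hx) continuousAt_id

/-- The states all of whose rows lie in the open half-space around `u` and project centrally into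
the closed ball of radius `ε` around `u`. -/
def nearConsensus (n : ℕ) (u : Vec d) (ε : ℝ) : Set (RowMat n d) :=
  {X | ∀ i, 0 < inner ℝ u (X i) ∧ centralProj u (X i) ∈ Metric.closedBall u ε}

/-- The weights with which the central projections of the rows are averaged in one step. -/
noncomputable def projWeight (A : Matrix (Fin n) (Fin n) ℝ) (u : Vec d) (X : RowMat n d)
    (i j : Fin n) : ℝ :=
  (∑ k, A i k * inner ℝ u (X k))⁻¹ * (A i j * inner ℝ u (X j))

variable {u : Vec d} {X : RowMat n d}

theorem inner_weightedSum_pos (hA : Admissible A γ) (hX : ∀ i, 0 < inner ℝ u (X i))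
    (i : Fin n) : 0 < ∑ k, A i k * inner ℝ u (X k) :=
  Finset.sum_pos' (fun k _ => mul_nonneg (hA.weight_nonneg i k) (hX k).le)
    ⟨i, Finset.mem_univ i, mul_pos (hA.diag_pos i) (hX i)⟩

theorem projWeight_nonneg (hA : Admissible A γ) (hX : ∀ i, 0 < inner ℝ u (X i))
    (i j : Fin n) : 0 ≤ projWeight A u X i j :=
  mul_nonneg (inv_nonneg.2 (inner_weightedSum_pos hA hX i).le)
    (mul_nonneg (hA.weight_nonneg i j) (hX j).le)

theorem sum_projWeight (hA : Admissible A γ) (hX : ∀ i, 0 < inner ℝ u (X i)) (i : Fin n) :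
    ∑ j, projWeight A u X i j = 1 := by
  simp only [projWeight, ← Finset.mul_sum]
  exact inv_mul_cancel₀ (inner_weightedSum_pos hA hX i).ne'

theorem inner_weightedSum (i : Fin n) :
    inner ℝ u (∑ j, A i j • X j) = ∑ k, A i k * inner ℝ u (X k) := by
  simp [inner_sum, inner_smul_right]

theorem exists_step_eq_smul (hA : Admissible A γ) (hX : X ∈ stateSpace γ) (i : Fin n) :
    ∃ r : ℝ, 0 < r ∧ step A γ X i = r • ∑ j, A i j • X j := by
  have h := hA.weightedSum_ne_zero hX i
  refine ⟨γ i (direction (∑ j, A i j • X j)) * ‖∑ j, A i j • X j‖⁻¹,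
    mul_pos ((hA.directional i).pos (direction_mem_unitSphere h))
      (inv_pos.2 (norm_pos_iff.2 h)), ?_⟩
  rw [mul_smul]
  rfl

theorem inner_step_pos (hA : Admissible A γ) (hX : X ∈ stateSpace γ)
    (hpos : ∀ i, 0 < inner ℝ u (X i)) (i : Fin n) : 0 < inner ℝ u (step A γ X i) := by
  obtain ⟨r, hr, h⟩ := exists_step_eq_smul hA hX i
  rw [h, inner_smul_right, inner_weightedSum]
  exact mul_pos hr (inner_weightedSum_pos hA hpos i)

/-- In central projection, the nonlinear step is an averaging of the rows. -/
theorem centralProj_step (hA : Admissible A γ) (hX : X ∈ stateSpace γ)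
    (hpos : ∀ i, 0 < inner ℝ u (X i)) (i : Fin n) :
    centralProj u (step A γ X i) = ∑ j, projWeight A u X i j • centralProj u (X j) := by
  obtain ⟨r, hr, h⟩ := exists_step_eq_smul hA hX i
  rw [h, centralProj_smul hr.ne', centralProj, inner_weightedSum, Finset.smul_sum]
  refine Finset.sum_congr rfl fun j _ => ?_
  simp only [projWeight, centralProj, smul_smul]
  congr 1
  field_simp [(hpos j).ne']

theorem step_mem_nearConsensus (hA : Admissible A γ) (hX : X ∈ stateSpace γ) {ε : ℝ}
    (hXu : X ∈ nearConsensus n u ε) : step A γ X ∈ nearConsensus n u ε := by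
  have hpos := fun i => (hXu i).1
  refine fun i => ⟨inner_step_pos hA hX hpos i, ?_⟩
  rw [centralProj_step hA hX hpos]
  exact (convex_closedBall u ε).sum_mem (fun j _ => projWeight_nonneg hA hpos i j)
    (sum_projWeight hA hpos i) fun j _ => (hXu j).2

/-- The averaging weights are bounded below on `nearConsensus`, because `⟪u, x⟫` is bounded above
by the norm of `x` and below by that norm divided by the norm of the central projection. -/
theorem exists_le_projWeight (hA : Admissible A γ) (hu : u ∈ unitSphere d) {ε : ℝ}
    (hε : 0 < ε) :
    ∃ η > 0, ∀ X ∈ stateSpace γ, X ∈ nearConsensus n u ε →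
      ∀ i j, 0 < A i j → η ≤ projWeight A u X i j := by
  have hu1 : ‖u‖ = 1 := by simpa using hu
  choose c C hc hC hγ using fun j => (hA.directional j).bounded
  have hpair : ∀ i j, ∀ᶠ η in 𝓝[>] (0 : ℝ), ∀ X ∈ stateSpace γ, X ∈ nearConsensus n u ε →
      0 < A i j → η ≤ projWeight A u X i j := by
    intro i j
    by_cases hij : 0 < A i j
    swap
    · exact Eventually.of_forall fun η X _ _ h => absurd h hij
    have hS : 0 < ∑ k, A i k * C k :=
      Finset.sum_pos' (fun k _ => mul_nonneg (hA.weight_nonneg i k) (hC k).le)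
        ⟨i, Finset.mem_univ i, mul_pos (hA.diag_pos i) (hC i)⟩
    have hpos : 0 < (∑ k, A i k * C k)⁻¹ * (A i j * (c j / (1 + ε))) :=
      mul_pos (inv_pos.2 hS) (mul_pos hij (div_pos (hc j) (by linarith)))
    filter_upwards [Ioo_mem_nhdsGT hpos] with η hη X hX hXu _
    refine hη.2.le.trans ?_
    have hnorm : ∀ k, c k ≤ ‖X k‖ ∧ ‖X k‖ ≤ C k := fun k => by
      rw [norm_of_mem_starBoundary (hA.directional k) (hX k)]
      exact hγ k _ (direction_of_mem_starBoundary (hA.directional k) (hX k)).1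
    have hupper : ∀ k, inner ℝ u (X k) ≤ C k := fun k =>
      (real_inner_le_norm _ _).trans (by rw [hu1, one_mul]; exact (hnorm k).2)
    have hlower : c j / (1 + ε) ≤ inner ℝ u (X j) := by
      have hp := (hXu j).1
      have h1 : ‖centralProj u (X j)‖ ≤ 1 + ε := by
        have := norm_le_norm_add_norm_sub' (centralProj u (X j)) u
        have h2 := (hXu j).2
        rw [mem_closedBall_iff_norm] at h2
        linarith
      rw [centralProj, norm_smul, norm_inv, Real.norm_of_nonneg hp.le, inv_mul_le_iff₀ hp] at h1
      rw [div_le_iff₀ (by linarith)]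
      exact (hnorm j).1.trans h1
    unfold projWeight
    refine mul_le_mul ?_ (mul_le_mul_of_nonneg_left hlower hij.le)
      (mul_pos hij (div_pos (hc j) (by linarith))).le
      (inv_nonneg.2 (inner_weightedSum_pos hA (fun i => (hXu i).1) i).le)
    exact inv_anti₀ (inner_weightedSum_pos hA (fun i => (hXu i).1) i)
      (Finset.sum_le_sum fun k _ => mul_le_mul_of_nonneg_left (hupper k) (hA.weight_nonneg i k))
  obtain ⟨η, hη, h0⟩ := ((eventually_all.2 fun i => eventually_all.2 fun j => hpair i j).and
    self_mem_nhdsWithin).exists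
  exact ⟨η, h0, fun X hX hXu i j hij => hη i j X hX hXu hij⟩

/-- A state all of whose rows lie in one open half-space around `u` leads to consensus, and the
consensus direction is that of a point of every ball around `u` containing the central projections
of the rows. -/
theorem exists_consensus_of_nearConsensus [NeZero n] (hA : Admissible A γ)
    (hu : u ∈ unitSphere d) {ε : ℝ} (hε : 0 < ε) (hX : X ∈ stateSpace γ)
    (hXu : X ∈ nearConsensus n u ε) :
    ∃ p ∈ Metric.closedBall u ε, p ≠ 0 ∧
      ∀ i, Tendsto (fun t => direction ((step A γ)^[t] X i)) atTop (𝓝 (direction p)) := by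
  have hmem : ∀ t, (step A γ)^[t] X ∈ stateSpace γ ∧ (step A γ)^[t] X ∈ nearConsensus n u ε := by
    intro t
    induction t with
    | zero => exact ⟨hX, hXu⟩
    | succ t ih =>
      rw [Function.iterate_succ_apply']
      exact ⟨hA.step_mem ih.1, step_mem_nearConsensus hA ih.1 ih.2⟩
  have hpos := fun t i => ((hmem t).2 i).1
  obtain ⟨η, hη, hle⟩ := exists_le_projWeight hA hu hε
  have hcoord : ∀ k : Fin d, ∃ c, ∀ i, Tendsto
      (fun t => centralProj u ((step A γ)^[t] X i) k) atTop (𝓝 c) := fun k =>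
    exists_tendsto_of_averaging (q := fun t i => centralProj u ((step A γ)^[t] X i) k)
      (B := fun t => projWeight A u ((step A γ)^[t] X)) (R := fun i j => 0 < A i j) hη
      (fun t => projWeight_nonneg hA (hpos t)) (fun t => sum_projWeight hA (hpos t))
      (fun t => hle _ (hmem t).1 (hmem t).2) hA.diag_pos hA.weight_connected
      (fun t i => by
        simp only [Function.iterate_succ_apply']
        rw [centralProj_step hA (hmem t).1 (hpos t)]
        simp)
  choose c hc using hcoord
  have hlim : ∀ i, Tendsto (fun t => centralProj u ((step A γ)^[t] X i)) atTop
      (𝓝 (WithLp.toLp 2 c)) := fun i =>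
    ((PiLp.continuous_toLp 2 _).tendsto c).comp
      (tendsto_pi_nhds.2 fun k => hc k i :
        Tendsto (fun t k => centralProj u ((step A γ)^[t] X i) k) atTop (𝓝 c))
  have hone : inner ℝ u (WithLp.toLp 2 c) = (1 : ℝ) := by
    refine tendsto_nhds_unique (tendsto_const_nhds.inner (hlim 0)) ?_
    refine tendsto_const_nhds.congr fun t => ?_
    rw [centralProj, inner_smul_right, inv_mul_cancel₀ (hpos t 0).ne']
  have hp0 : (WithLp.toLp 2 c : Vec d) ≠ 0 := fun h => by simp [h] at hone
  refine ⟨WithLp.toLp 2 c, Metric.isClosed_closedBall.mem_of_tendsto (hlim 0)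
    (Eventually.of_forall fun t => ((hmem t).2 0).2), hp0, fun i => ?_⟩
  refine ((continuousAt_direction hp0).tendsto.comp (hlim i)).congr fun t => ?_
  exact direction_centralProj (hpos t i)

end Hemisphere

/-! ### Stability of consensus under perturbation of the initial state -/

section Consensus

variable {n d : ℕ} {A : Matrix (Fin n) (Fin n) ℝ} {γ : Fin n → Vec d → ℝ} {t₀ : ℕ}

theorem directionsTendTo_traj_iff {X₀ : RowMat n d} {u : Vec d} :
    DirectionsTendTo (traj A γ t₀ X₀) u ↔
      ∀ i, Tendsto (fun t => direction ((step A γ)^[t] X₀ i)) atTop (𝓝 u) := by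
  refine forall_congr' fun i => ?_
  rw [← tendsto_iff_norm_sub_tendsto_zero,
    ← tendsto_add_atTop_iff_nat (f := fun t => direction (traj A γ t₀ X₀ t i)) t₀]
  simp [traj]

/-- States whose trajectory gets close to consensus in the direction `u` lead to consensus, in
a direction close to `u`. The time at which the trajectory of `X₀` is close to consensus serves
for all nearby states, as the iterates of the step are continuous. -/
theorem eventually_exists_consensus [NeZero n] (hA : Admissible A γ) {u : Vec d}
    (hu : u ∈ unitSphere d) {X₀ : stateSpace γ}
    (hX₀ : DirectionsTendTo (traj A γ t₀ X₀) u) {V : Set (Vec d)} (hV : V ∈ 𝓝 u) :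
    ∀ᶠ X : stateSpace γ in 𝓝 X₀, ∃ v ∈ V, v ∈ unitSphere d ∧ DirectionsTendTo (traj A γ t₀ X) v := by
  have hu0 := ne_zero_of_mem_unitSphere hu
  have huu := inner_self_of_mem_unitSphere hu
  have hdir : Tendsto direction (𝓝 u) (𝓝 u) := by
    simpa only [ContinuousAt, direction_of_mem_unitSphere hu] using continuousAt_direction hu0
  have hproj : Tendsto (centralProj u) (𝓝 u) (𝓝 u) := by
    have := continuousAt_centralProj (u := u) (x := u) (by rw [huu]; exact one_ne_zero)
    rwa [ContinuousAt, show centralProj u u = u by rw [centralProj, huu, inv_one, one_smul]] at this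
  obtain ⟨ε, hε, hεV⟩ := Metric.nhds_basis_closedBall.mem_iff.1 (hdir hV)
  have hgood : ∀ᶠ x in 𝓝 u, 0 < inner ℝ u x ∧ centralProj u x ∈ Metric.closedBall u ε :=
    (((continuous_const.inner continuous_id).tendsto u).eventually_const_lt
      (by rw [id, huu]; exact one_pos)).and (hproj (Metric.closedBall_mem_nhds u hε))
  rw [eventually_nhds_iff] at hgood
  obtain ⟨W, hW, hWo, huW⟩ := hgood
  rw [directionsTendTo_traj_iff] at hX₀
  obtain ⟨T, hT⟩ := (eventually_all.2 fun i => hX₀ i (hWo.mem_nhds huW)).exists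
  have hcont : ∀ i, ContinuousAt
      (fun X : stateSpace γ => direction ((step A γ)^[T] (X : RowMat n d) i)) X₀ := fun i =>
    ContinuousAt.comp (g := direction) (f := fun X : stateSpace γ => (step A γ)^[T] X.1 i)
      (continuousAt_direction
        (ne_zero_of_mem_starBoundary (hA.directional i) (hA.iterate_mem X₀.2 T i)))
      ((continuous_apply i).comp (hA.continuousOn_iterate T).domRestrict).continuousAt
  filter_upwards [eventually_all.2 fun i => hcont i (hWo.mem_nhds (hT i))] with X hXW
  have hne : ∀ i, (step A γ)^[T] X.1 i ≠ 0 := fun i =>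
    ne_zero_of_mem_starBoundary (hA.directional i) (hA.iterate_mem X.2 T i)
  have hnear : (step A γ)^[T] X.1 ∈ nearConsensus n u ε := fun i => by
    obtain ⟨h1, h2⟩ := hW _ (hXW i)
    rw [centralProj_direction u (hne i)] at h2
    rw [direction, inner_smul_right] at h1
    exact ⟨pos_of_mul_pos_right h1 (inv_nonneg.2 (norm_nonneg _)), h2⟩
  obtain ⟨p, hp, hp0, hlim⟩ :=
    exists_consensus_of_nearConsensus hA hu hε (hA.iterate_mem X.2 T) hnear
  refine ⟨direction p, hεV hp, direction_mem_unitSphere hp0,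
    directionsTendTo_traj_iff.2 fun i => ?_⟩
  rw [← tendsto_add_atTop_iff_nat T]
  simpa only [Function.iterate_add_apply] using hlim i

theorem directionsTendTo_unique [NeZero n] {X : ℕ → RowMat n d} {u v : Vec d}
    (hu : DirectionsTendTo X u) (hv : DirectionsTendTo X v) : u = v :=
  tendsto_nhds_unique (tendsto_iff_norm_sub_tendsto_zero.2 (hu 0))
    (tendsto_iff_norm_sub_tendsto_zero.2 (hv 0))

/-- A star boundary is parametrized continuously by directions, so the states converge as soon as
their directions do. -/
theorem tendsto_traj (hA : Admissible A γ) (X₀ : stateSpace γ) {u : Vec d}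
    (hu : u ∈ unitSphere d) (h : DirectionsTendTo (traj A γ t₀ X₀) u) :
    Tendsto (traj A γ t₀ X₀) atTop (𝓝 fun i => γ i u • u) := by
  refine tendsto_pi_nhds.2 fun i => ?_
  have hmem := fun t => direction_of_mem_starBoundary (hA.directional i)
    (hA.iterate_mem X₀.2 (t - t₀) i)
  have hdir : Tendsto (fun t => direction (traj A γ t₀ X₀ t i)) atTop (𝓝 u) :=
    tendsto_iff_norm_sub_tendsto_zero.2 (h i)
  have hγ := ((hA.directional i).continuousOn u hu).tendsto.comp
    (tendsto_nhdsWithin_iff.2 ⟨hdir, Eventually.of_forall fun t => (hmem t).1⟩)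
  exact (hγ.smul hdir).congr fun t => (hmem t).2.symm

end Consensus

end StarConsensus

theorem mainTheorem5 {n d : ℕ} (A : Matrix (Fin n) (Fin n) ℝ)
    (γ : Fin n → StarConsensus.Vec d → ℝ) (hA : StarConsensus.Admissible A γ) (t₀ : ℕ) :
    IsOpen (StarConsensus.consensusSet A γ t₀) ∧
    ∃ (u : StarConsensus.stateSpace γ → StarConsensus.Vec d)
      (Xlim : StarConsensus.stateSpace γ → StarConsensus.RowMat n d),
      (∀ X₀ ∈ StarConsensus.consensusSet A γ t₀,
        u X₀ ∈ StarConsensus.unitSphere d ∧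
        StarConsensus.DirectionsTendTo (StarConsensus.traj A γ t₀ X₀) (u X₀) ∧
        Tendsto (StarConsensus.traj A γ t₀ X₀) atTop (𝓝 (Xlim X₀)) ∧
        ∀ i, Xlim X₀ i = γ i (u X₀) • u X₀) ∧
      ContinuousOn u (StarConsensus.consensusSet A γ t₀) ∧
      ContinuousOn Xlim (StarConsensus.consensusSet A γ t₀) := by
  have hex : ∀ X₀ : StarConsensus.stateSpace γ, ∃ u : StarConsensus.Vec d,
      X₀ ∈ StarConsensus.consensusSet A γ t₀ → u ∈ StarConsensus.unitSphere d ∧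
        StarConsensus.DirectionsTendTo (StarConsensus.traj A γ t₀ X₀) u := by
    intro X₀
    by_cases h : X₀ ∈ StarConsensus.consensusSet A γ t₀
    · obtain ⟨u, hu, hlim⟩ := h
      exact ⟨u, fun _ => ⟨hu, hlim⟩⟩
    · exact ⟨0, fun h' => absurd h' h⟩
  choose u hu using hex
  have key : IsOpen (StarConsensus.consensusSet A γ t₀) ∧
      ContinuousOn u (StarConsensus.consensusSet A γ t₀) := by
    -- For `n = 0` the consensus direction is not unique, but there is only one state.
    obtain rfl | hn := Nat.eq_zero_or_pos n
    · exact ⟨isOpen_discrete _, continuous_of_discreteTopology.continuousOn⟩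
    have : NeZero n := ⟨hn.ne'⟩
    refine ⟨isOpen_iff_mem_nhds.2 fun X₀ hX₀ => ?_, fun X₀ hX₀ V hV => ?_⟩
    · filter_upwards [StarConsensus.eventually_exists_consensus hA (hu X₀ hX₀).1 (hu X₀ hX₀).2
        univ_mem] with X hX
      obtain ⟨v, -, hv, hlim⟩ := hX
      exact ⟨v, hv, hlim⟩
    · refine mem_nhdsWithin_of_mem_nhds ?_
      filter_upwards [StarConsensus.eventually_exists_consensus hA (hu X₀ hX₀).1 (hu X₀ hX₀).2
        hV] with X hX
      obtain ⟨v, hvV, hv, hlim⟩ := hX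
      have := StarConsensus.directionsTendTo_unique (hu X ⟨v, hv, hlim⟩).2 hlim
      rwa [Set.mem_preimage, this]
  refine ⟨key.1, u, fun X₀ i => γ i (u X₀) • u X₀, fun X₀ hX₀ =>
    ⟨(hu X₀ hX₀).1, (hu X₀ hX₀).2,
      StarConsensus.tendsto_traj hA X₀ (hu X₀ hX₀).1 (hu X₀ hX₀).2, fun _ => rfl⟩, key.2, ?_⟩
  exact continuousOn_pi.2 fun i => ((hA.directional i).continuousOn.comp key.2
    fun X₀ hX₀ => (hu X₀ hX₀).1).smul key.2
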